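/- Let $X,Y$ be complex Banach spaces with open unit balls $B_X,B_Y$. Let $\mathcal H^\infty(B_X)$ be the Banach algebra of bounded holomorphic functions on $B_X$ with the supremum norm, $\mathcal H^\infty(B_Y,X^{**})$ the Banach space of bounded holomorphic maps $B_Y\to X^{**}$ with the supremum norm, and $\mathcal M_\infty(B_X,B_Y)$ the set of non-null algebra homomorphisms $\Phi:\mathcal H^\infty(B_X)\to\mathcal H^\infty(B_Y)$. These are automatically continuous, and $\mathcal M_\infty(B_X,B_Y)$ carries the Gleason metric $\|\Phi-\Psi\|$ (operator norm). For $g\in\mathcal H^\infty(B_Y,X^{**})$ with $\|g\|\le 1$, the fiber over $g$ is $$\mathscr F(g)=\{\Phi\in\mathcal M_\infty(B_X,B_Y):\ \Phi(x^*)(y)=g(y)(x^*)\ \text{ for all } y\in B_Y,\ x^*\in X^*\}.$$ For $f\in\mathcal H^\infty(B_X)$ let $\widetilde f\in\mathcal H^\infty(B_{X^{**}})$ be its canonical (Aron--Berner, Davie--Gamelin) extension: $\widetilde f(z)=\sum_m \widetilde{P_m}(z)$, where $\sum_m P_m$ is the Taylor series of $f$ at $0$ and $\widetilde{P_m}(z)$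 is the value on the diagonal of the Arens extension to $X^{**}$ of the symmetric $m$-linear form of $P_m$. Let $\theta:B_X\to B_X$ be an automorphism, that is, a biholomorphic bijection. 1. The map $\Lambda_\theta:\mathcal M_\infty(B_X,B_Y)\to\mathcal M_\infty(B_X,B_Y)$, $\Lambda_\theta(\Phi)(f)=\Phi(f\circ\theta)$, is a bijective isometry with respect to the Gleason metric. 2. Suppose moreover that $X$ is symmetrically regular (every continuous linear $T:X\to X^*$ with $T(x_1)(x_2)=T(x_2)(x_1)$ for all $x_1,x_2$ is weakly compact) and that for every $x^*\in X^*$ both $x^*\circ\theta$ and $x^*\circ\theta^{-1}$ are limits, uniformly on $B_X$, of finite type polynomials, i.e. of linear combinations of powers $(x_k^*)^m$ with $x_k^*\in X^*$ and $m\ge 0$. Then there is exactly one weak-star to weak-star continuous map $\widetilde\theta:\overline B_{X^{**}}\to\overline B_{X^{**}}$ such that $\widetilde\theta(z)(x^*)=\widetilde{x^*\circ\theta}(z)$ for all $z\in B_{X^{**}}$ and $x^*\in X^*$; and for every $g\in\mathcal H^\infty(B_Y,X^{**})$ with $\|g\|\le 1$, the map $\widetilde\theta\circ g$ belongs to the closed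 unit ball of $\mathcal H^\infty(B_Y,X^{**})$ and $$\Lambda_\theta(\mathscr F(g))=\mathscr F(\widetilde\theta\circ g).$$ -/

import Mathlib

open Metric Set Topology
open scoped BoundedContinuousFunction

namespace VectorSpectrum

/-- The open unit ball of a normed space, as a type. -/
abbrev UnitBall (X : Type*) [NormedAddCommGroup X] : Type _ := ↥(ball (0 : X) 1)

/-- The bidual with its norm topology. -/
abbrev Bidual (X : Type*) [NormedAddCommGroup X] [NormedSpace ℂ X] : Type _ :=
  StrongDual ℂ (StrongDual ℂ X)

section Holomorphic

variable {X E : Type*} [NormedAddCommGroup X] [NormedSpace ℂ X]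
  [NormedAddCommGroup E] [NormedSpace ℂ E]

/-- Extension of a map on the open unit ball to the whole space, by zero. -/
noncomputable def zeroExt (f : UnitBall X → E) : X → E :=
  Function.extend Subtype.val f 0

/-- A map on the open unit ball is holomorphic if, near every point of the ball, it is the sum of
a power series of continuous homogeneous polynomials. -/
def IsHolo (f : UnitBall X → E) : Prop :=
  AnalyticOnNhd ℂ (zeroExt f) (ball (0 : X) 1)

theorem zeroExt_apply (f : UnitBall X → E) (x : UnitBall X) : zeroExt f x = f x :=
  Subtype.val_injective.extend_apply f 0 x

theorem zeroExt_of_mem (f : UnitBall X → E) {x : X} (hx : x ∈ ball (0 : X) 1) :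
    zeroExt f x = f ⟨x, hx⟩ :=
  zeroExt_apply f ⟨x, hx⟩

theorem isHolo_of_agree {f : UnitBall X → E} {F : X → E}
    (hF : AnalyticOnNhd ℂ F (ball (0 : X) 1)) (h : ∀ x : UnitBall X, F x = f x) : IsHolo f :=
  hF.congr isOpen_ball fun x hx => by rw [zeroExt_of_mem f hx]; exact h ⟨x, hx⟩

end Holomorphic

section Spaces

variable (X E : Type*) [NormedAddCommGroup X] [NormedSpace ℂ X]
  [NormedAddCommGroup E] [NormedSpace ℂ E]

/-- The space of bounded holomorphic maps from the open unit ball of `X` to `E`, with the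
supremum norm. -/
noncomputable def HInfVec : Submodule ℂ (UnitBall X →ᵇ E) where
  carrier := {f | IsHolo (f : UnitBall X → E)}
  add_mem' {f g} hf hg := isHolo_of_agree (AnalyticOnNhd.add hf hg) fun x => by
    simp [zeroExt_apply]
  zero_mem' := isHolo_of_agree (F := fun _ => 0) analyticOnNhd_const fun x => by simp
  smul_mem' c f hf := isHolo_of_agree (AnalyticOnNhd.smul (analyticOnNhd_const (v := c)) hf)
    fun x => by simp [zeroExt_apply]

/-- The Banach algebra of bounded holomorphic functions on the open unit ball of `X`, with the
supremum norm. -/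
noncomputable def HInf : Subalgebra ℂ (UnitBall X →ᵇ ℂ) where
  carrier := {f | IsHolo (f : UnitBall X → ℂ)}
  add_mem' {f g} hf hg := isHolo_of_agree (AnalyticOnNhd.add hf hg) fun x => by
    simp [zeroExt_apply]
  mul_mem' {f g} hf hg := isHolo_of_agree (AnalyticOnNhd.mul hf hg) fun x => by
    simp [zeroExt_apply]
  algebraMap_mem' c := isHolo_of_agree (F := fun _ => c) analyticOnNhd_const fun x => by
    simp [BoundedContinuousFunction.algebraMap_apply]

end Spaces

section Spectrum

variable (X Y : Type*) [NormedAddCommGroup X] [NormedSpace ℂ X]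
  [NormedAddCommGroup Y] [NormedSpace ℂ Y]

/-- The vector-valued spectrum: non-null algebra homomorphisms between the algebras of bounded
holomorphic functions. Neither continuity nor preservation of the unit is required. -/
structure MInf where
  toHom : HInf X →ₙₐ[ℂ] HInf Y
  ne_zero : toHom ≠ 0

variable {X Y}

theorem MInf.ext' {Φ Ψ : MInf X Y} (h : ∀ f, Φ.toHom f = Ψ.toHom f) : Φ = Ψ := by
  obtain ⟨Φ, _⟩ := Φ
  obtain ⟨Ψ, _⟩ := Ψ
  obtain rfl : Φ = Ψ := NonUnitalAlgHom.ext h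
  rfl

theorem HInf.norm_apply_le (f : HInf X) (x : UnitBall X) : ‖f.1 x‖ ≤ ‖f‖ :=
  f.1.norm_coe_le_norm x

theorem HInf.ext' {f g : HInf X} (h : ∀ x, f.1 x = g.1 x) : f = g :=
  Subtype.ext (BoundedContinuousFunction.ext h)

/-- If `c` has modulus larger than the norm of `f`, then `c - f` is invertible. -/
theorem HInf.exists_inverse (f : HInf X) (c : ℂ) (hc : ‖f‖ < ‖c‖) :
    ∃ h : HInf X, (algebraMap ℂ (HInf X) c - f) * h = 1 := by
  have hfx : ∀ x, ‖f.1 x‖ ≤ ‖f‖ := HInf.norm_apply_le f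
  have hlow : ∀ x, ‖c‖ - ‖f‖ ≤ ‖c - f.1 x‖ := fun x =>
    (sub_le_sub_left (hfx x) _).trans (norm_sub_norm_le _ _)
  have hpos : 0 < ‖c‖ - ‖f‖ := sub_pos.2 hc
  have hne : ∀ x, c - f.1 x ≠ 0 := fun x => norm_pos_iff.1 (hpos.trans_le (hlow x))
  have hcont : Continuous fun x => (c - f.1 x)⁻¹ :=
    (continuous_const.sub f.1.continuous).inv₀ hne
  refine ⟨⟨BoundedContinuousFunction.ofNormedAddCommGroup _ hcont (‖c‖ - ‖f‖)⁻¹ fun x => ?_, ?_⟩, ?_⟩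
  · rw [norm_inv]
    exact inv_anti₀ hpos (hlow x)
  · refine isHolo_of_agree (F := fun x => (c - zeroExt f.1 x)⁻¹) ?_ fun x => ?_
    · refine AnalyticOnNhd.inv (analyticOnNhd_const.sub f.2) fun x hx => ?_
      rw [zeroExt_of_mem _ hx]
      exact hne _
    · rw [zeroExt_apply]; rfl
  · refine HInf.ext' fun x => ?_
    exact mul_inv_cancel₀ (hne x)

/-- Algebra homomorphisms between these algebras are automatically contractive. -/
theorem MInf.norm_apply_le (Φ : MInf X Y) (f : HInf X) : ‖Φ.toHom f‖ ≤ ‖f‖ := by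
  refine (BoundedContinuousFunction.norm_le (f := (Φ.toHom f).1) (norm_nonneg f)).2 fun y => ?_
  by_contra hcon
  have hlt : ‖f‖ < ‖(Φ.toHom f).1 y‖ := not_le.1 hcon
  obtain ⟨h, hh⟩ := HInf.exists_inverse f _ hlt
  have key : f = f * (algebraMap ℂ (HInf X) ((Φ.toHom f).1 y) - f) * h := by
    rw [mul_assoc, hh, mul_one]
  have h1 : f * (algebraMap ℂ (HInf X) ((Φ.toHom f).1 y) - f) = ((Φ.toHom f).1 y) • f - f * f := by
    rw [mul_sub, mul_comm f (algebraMap _ _ _), ← Algebra.smul_def]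
  have h2 : (Φ.toHom f).1 y = 0 := by
    have e : Φ.toHom f = (((Φ.toHom f).1 y) • Φ.toHom f - Φ.toHom f * Φ.toHom f) * Φ.toHom h := by
      conv_lhs => rw [key, h1, map_mul, map_sub, map_smul, map_mul]
    have e' := congrArg (fun F : HInf Y => F.1 y) e
    change (Φ.toHom f).1 y = ((Φ.toHom f).1 y * (Φ.toHom f).1 y - (Φ.toHom f).1 y * (Φ.toHom f).1 y)
      * (Φ.toHom h).1 y at e'
    rw [e', sub_self, zero_mul]
  rw [h2, norm_zero] at hlt
  exact absurd hlt (not_lt.2 (norm_nonneg _))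

/-- The inclusion of the spectrum in the space of bounded operators. -/
noncomputable def MInf.toCLM (Φ : MInf X Y) : HInf X →L[ℂ] HInf Y :=
  LinearMap.mkContinuous
    { toFun := fun f => Φ.toHom f
      map_add' := fun f g => map_add Φ.toHom f g
      map_smul' := fun c f => map_smul Φ.toHom c f } 1
    fun f => (MInf.norm_apply_le Φ f).trans (one_mul ‖f‖).ge

theorem MInf.toCLM_injective : Function.Injective (MInf.toCLM (X := X) (Y := Y)) := by
  intro Φ Ψ h
  refine MInf.ext' fun f => ?_
  exact congrArg (fun T : HInf X →L[ℂ] HInf Y => T f) h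

/-- The Gleason metric: the distance of `Φ` and `Ψ` is the operator norm of `Φ - Ψ`. -/
noncomputable instance : MetricSpace (MInf X Y) :=
  MetricSpace.induced MInf.toCLM MInf.toCLM_injective inferInstance

theorem MInf.dist_eq (Φ Ψ : MInf X Y) : dist Φ Ψ = ‖Φ.toCLM - Ψ.toCLM‖ :=
  dist_eq_norm Φ.toCLM Ψ.toCLM

/-- The restriction of a continuous linear functional to the open unit ball. -/
noncomputable def linFun (φ : StrongDual ℂ X) : HInf X :=
  ⟨BoundedContinuousFunction.ofNormedAddCommGroup (fun x : UnitBall X => φ x)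
      (φ.continuous.comp continuous_subtype_val) ‖φ‖ fun x =>
        φ.le_of_opNorm_le_of_le le_rfl (mem_ball_zero_iff.1 x.2).le |>.trans (mul_one _).le,
    isHolo_of_agree (F := φ) (φ.analyticOnNhd _) fun _ => rfl⟩

theorem norm_linFun_le (φ : StrongDual ℂ X) : ‖linFun φ‖ ≤ ‖φ‖ :=
  (BoundedContinuousFunction.norm_le (f := (linFun φ).1) (norm_nonneg φ)).2 fun x =>
    φ.le_of_opNorm_le_of_le le_rfl (mem_ball_zero_iff.1 x.2).le |>.trans (mul_one _).le

/-- The projection `ξ`: it sends `Φ` to the map taking `y` to the element `φ ↦ Φ(φ)(y)` of the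
bidual. -/
noncomputable def MInf.xi (Φ : MInf X Y) (y : UnitBall Y) : Bidual X :=
  LinearMap.mkContinuous
    { toFun := fun φ => (Φ.toHom (linFun φ)).1 y
      map_add' := fun φ ψ => by
        have : linFun (φ + ψ) = linFun φ + linFun ψ := HInf.ext' fun _ => rfl
        rw [this, map_add]; rfl
      map_smul' := fun c φ => by
        have : linFun (c • φ) = c • linFun φ := HInf.ext' fun _ => rfl
        rw [this, map_smul]; rfl } 1
    fun φ => by
      rw [one_mul]
      refine (HInf.norm_apply_le (Φ.toHom (linFun φ)) y).trans
        ((MInf.norm_apply_le Φ (linFun φ)).trans ?_)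
      exact norm_linFun_le φ

/-- The fiber over a bounded holomorphic map with values in the bidual. -/
def fiber (g : HInfVec Y (Bidual X)) : Set (MInf X Y) :=
  {Φ | ∀ y, Φ.xi y = g.1 y}

end Spectrum

section Automorphism

/-- Automorphisms (biholomorphic bijections) of the open unit ball. -/
structure BallAut (X : Type*) [NormedAddCommGroup X] [NormedSpace ℂ X]
    extends UnitBall X ≃ UnitBall X where
  holo_toFun : IsHolo fun x => (toFun x : X)
  holo_invFun : IsHolo fun x => (invFun x : X)

variable {X Y : Type*} [NormedAddCommGroup X] [NormedSpace ℂ X]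
  [NormedAddCommGroup Y] [NormedSpace ℂ Y]

/-- The inverse automorphism. -/
def BallAut.symm (θ : BallAut X) : BallAut X where
  toEquiv := θ.toEquiv.symm
  holo_toFun := θ.holo_invFun
  holo_invFun := θ.holo_toFun

theorem IsHolo.continuous {E : Type*} [NormedAddCommGroup E] [NormedSpace ℂ E]
    {f : UnitBall X → E} (hf : IsHolo f) : Continuous f := by
  have h : f = (ball (0 : X) 1).domRestrict (zeroExt f) := by
    funext x
    exact (zeroExt_apply f x).symm
  rw [h]
  exact hf.continuousOn.domRestrict

theorem BallAut.continuous (θ : BallAut X) : Continuous θ.toFun :=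
  continuous_induced_rng.2 θ.holo_toFun.continuous

/-- Composition with an automorphism, `f ↦ f ∘ θ`, as an algebra homomorphism. -/
noncomputable def BallAut.comp (θ : BallAut X) : HInf X →ₐ[ℂ] HInf X where
  toFun f := ⟨f.1.compContinuous ⟨θ.toFun, θ.continuous⟩, by
    refine isHolo_of_agree (F := fun x => zeroExt f.1 (zeroExt (fun x => (θ.toFun x : X)) x)) ?_ ?_
    · refine AnalyticOnNhd.comp f.2 θ.holo_toFun fun x hx => ?_
      rw [zeroExt_of_mem _ hx]
      exact (θ.toFun ⟨x, hx⟩).2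
    · intro x
      rw [zeroExt_apply, zeroExt_apply]
      rfl⟩
  map_one' := HInf.ext' fun _ => rfl
  map_mul' _ _ := HInf.ext' fun _ => rfl
  map_zero' := HInf.ext' fun _ => rfl
  map_add' _ _ := HInf.ext' fun _ => rfl
  commutes' _ := HInf.ext' fun _ => rfl

/-- The map `Λ_θ`, sending `Φ` to `f ↦ Φ(f ∘ θ)`. -/
noncomputable def Lam (θ : BallAut X) (Φ : MInf X Y) : MInf X Y :=
  ⟨Φ.toHom.comp (θ.comp : HInf X →ₙₐ[ℂ] HInf X), fun h => Φ.ne_zero <| NonUnitalAlgHom.ext fun f => by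
    have h1 := congrArg (fun T : HInf X →ₙₐ[ℂ] HInf Y => T (θ.symm.comp f)) h
    have h2 : θ.comp (θ.symm.comp f) = f := HInf.ext' fun x =>
      congrArg f.1 (θ.toEquiv.symm_apply_apply x)
    change Φ.toHom (θ.comp (θ.symm.comp f)) = 0 at h1
    rw [h2] at h1
    exact h1⟩

end Automorphism

section CanonicalExtension

variable {X Y : Type*} [NormedAddCommGroup X] [NormedSpace ℂ X]
  [NormedAddCommGroup Y] [NormedSpace ℂ Y]

/-- The Arens extension of continuous multilinear forms to the bidual, evaluated at a tuple `z`
of bidual elements, by recursion on the number of variables: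
`Ã(z₀, …, zₘ) = z₀ (x₀ ↦ (A(x₀, ·))~(z₁, …, zₘ))`. In terms of nets in `X` converging weak-star to
the `zᵢ`, this is the iterated limit of `A(x₀, …, xₘ)`. -/
noncomputable def arensExt : (m : ℕ) → (Fin m → Bidual X) →
    ContinuousMultilinearMap ℂ (fun _ : Fin m => X) ℂ →L[ℂ] ℂ
  | 0, _ => (ContinuousMultilinearMap.apply ℂ (fun _ : Fin 0 => X) ℂ) 0
  | m + 1, z =>
    (z 0).comp
      ((ContinuousLinearMap.compL ℂ X (ContinuousMultilinearMap ℂ (fun _ : Fin m => X) ℂ) ℂ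
          (arensExt m (Fin.tail z))).comp
        (continuousMultilinearCurryLeftEquiv ℂ (fun _ : Fin (m + 1) => X) ℂ
          : ContinuousMultilinearMap ℂ (fun _ : Fin (m + 1) => X) ℂ →L[ℂ]
            X →L[ℂ] ContinuousMultilinearMap ℂ (fun _ : Fin m => X) ℂ))

/-- The symmetric multilinear form of the `m`-homogeneous Taylor polynomial of `f` at `0`. -/
noncomputable def taylorForm (f : HInf X) (m : ℕ) :
    ContinuousMultilinearMap ℂ (fun _ : Fin m => X) ℂ :=
  ((m.factorial : ℂ)⁻¹) • iteratedFDeriv ℂ m (zeroExt f.1) 0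

/-- The canonical (Aron–Berner, Davie–Gamelin) extension of a bounded holomorphic function to the
open unit ball of the bidual: each Taylor polynomial at `0` is extended by evaluating the Arens
extension of its symmetric form on the diagonal. The values outside the open ball are irrelevant. -/
noncomputable def canonicalExt (f : HInf X) (z : Bidual X) : ℂ :=
  ∑' m : ℕ, arensExt m (fun _ => z) (taylorForm f m)

/-- The closed unit ball of the bidual with the weak-star topology. -/
abbrev BidualBall (X : Type*) [NormedAddCommGroup X] [NormedSpace ℂ X] : Type _ :=
  ↥{z : WeakDual ℂ (StrongDual ℂ X) | ‖WeakDual.toStrongDual z‖ ≤ 1}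

/-- The value at `y` of a map in the closed unit ball of the space of bounded holomorphic maps, as
a point of the closed unit ball of the bidual. -/
noncomputable def valueInBall (g : HInfVec Y (Bidual X)) (hg : ‖g‖ ≤ 1) (y : UnitBall Y) : BidualBall X :=
  ⟨StrongDual.toWeakDual (g.1 y), (g.1.norm_coe_le_norm y).trans hg⟩

/-- `T` is the canonical extension `θ̃` of `θ` to the closed unit ball of the bidual: on the open
ball it is given by `θ̃(z)(φ) = (φ ∘ θ)~(z)`, and it is weak-star to weak-star continuous on the
closed ball. -/
def IsCanonicalExtension (θ : BallAut X) (T : BidualBall X → BidualBall X) : Prop :=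
  Continuous T ∧
    ∀ z : BidualBall X, ‖WeakDual.toStrongDual z.1‖ < 1 → ∀ φ : StrongDual ℂ X,
      (T z).1 φ = canonicalExt (θ.comp (linFun φ)) (WeakDual.toStrongDual z.1)

end CanonicalExtension

section Hypotheses

variable (X : Type*) [NormedAddCommGroup X] [NormedSpace ℂ X]

/-- Every symmetric continuous linear map from `X` to its dual is weakly compact, that is, it maps
the closed unit ball to a relatively weakly compact set. -/
def SymmetricallyRegular : Prop :=
  ∀ T : X →L[ℂ] StrongDual ℂ X, (∀ x y, T x y = T y x) →
    IsCompact (closure (toWeakSpace ℂ (StrongDual ℂ X) '' (T '' closedBall 0 1)))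

/-- Finite type polynomials, as functions on the open unit ball: linear combinations of powers of
continuous linear functionals (constants included, as zeroth powers). -/
noncomputable def finiteTypePoly : Submodule ℂ (HInf X) :=
  Submodule.span ℂ {p | ∃ (φ : StrongDual ℂ X) (m : ℕ), p = linFun φ ^ m}

end Hypotheses

end VectorSpectrum

/-! Composition with `θ` is a contractive automorphism of the algebra of bounded holomorphic
functions, with inverse composition with `θ.symm`. Hence `Lam θ` and `Lam θ.symm` are mutually
inverse and both 1-Lipschitz for the Gleason metric, which gives the first part.

For the second part, each `z` in the closed ball of the bidual is, by Goldstine, a weak-star limit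
of points of the ball, and limits along an ultrafilter give a contractive character `character z`
extending `z` from linear functionals to all bounded holomorphic functions. The character depends on
the ultrafilter, but its restriction to the closed subalgebra `linAlg X` generated by the
functionals does not: contractive characters that agree on functionals agree there
(`character_eq_of_linFun`). By hypothesis each `φ ∘ θ` and `φ ∘ θ⁻¹` lies in `linAlg X`. So `extend
θ z`, defined as `φ ↦ character z (φ ∘ θ)`, is weak-star continuous in `z` and is inverted by
`extend θ.symm`. It agrees with the canonical extension because on uniform limits of finite type
polynomials the extended Taylor series sums to the character (`canonicalExt_eq_character`).
Uniqueness follows from weak-star density of the open ball.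

For the fibers, `f ↦ Φ(f)(y)` is also a contractive unital character. If `Φ` lies over `g`, it must
agree with the character at `g y` on `linAlg X`, so `Lam θ Φ` lies over `extend θ ∘ g`; the same
argument for `θ.symm` gives the reverse inclusion. Norm holomorphy of `extend θ ∘ g` comes from
holomorphy of the evaluation map into the dual of the algebra (`isHolo_evalAt`), which rests on
Cauchy estimates. -/

namespace VectorSpectrum

/-! ### Normed structures on the algebra and the duals -/

section Instances

variable {X : Type*} [NormedAddCommGroup X] [NormedSpace ℂ X]

noncomputable scoped instance : NormedAddCommGroup (HInf X) := inferInstance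

noncomputable scoped instance : NormedSpace ℂ (HInf X) := inferInstance

noncomputable scoped instance : NormedAddCommGroup (StrongDual ℂ (HInf X)) := inferInstance

noncomputable scoped instance : NormedSpace ℂ (StrongDual ℂ (HInf X)) := inferInstance

noncomputable scoped instance : NormedAddCommGroup (Bidual X) := inferInstance

noncomputable scoped instance : NormedSpace ℂ (Bidual X) := inferInstance

end Instances

/-! ### Cauchy estimates, holomorphy of point evaluation, and completeness -/

section Cauchy

variable {X E : Type*} [NormedAddCommGroup X] [NormedSpace ℂ X]
  [NormedAddCommGroup E] [NormedSpace ℂ E]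

/-- Cauchy estimates for the iterated derivatives of a bounded holomorphic map. -/
theorem norm_iteratedFDeriv_le_of_bounded {f : X → E} {U : Set X} (hU : IsOpen U)
    (hf : AnalyticOnNhd ℂ f U) {M : ℝ} (hM : ∀ x ∈ U, ‖f x‖ ≤ M) {s : ℝ} (hs : 0 < s) (k : ℕ) :
    ∀ x, closedBall x (k * s) ⊆ U → ‖iteratedFDeriv ℂ k f x‖ ≤ (2 / s) ^ k * M := by
  induction k with
  | zero =>
    intro x hx
    rw [norm_iteratedFDeriv_zero, pow_zero, one_mul]
    exact hM x (hx (mem_closedBall_self (by simp)))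
  | succ k ih =>
    intro x hx
    have hsub : ∀ y ∈ ball x s, closedBall y (k * s) ⊆ U := fun y hy =>
      (closedBall_subset_closedBall' (by
        push_cast
        linarith [mem_ball.1 hy])).trans hx
    have hd : DifferentiableOn ℂ (iteratedFDeriv ℂ k f) (ball x s) := fun y hy =>
      ((hf.iteratedFDeriv_of_isOpen hU k) y
        (hsub y hy (mem_closedBall_self (by positivity)))).differentiableAt.differentiableWithinAt
    -- Centering the target at the value at `x` doubles the bound; the Schwarz-type estimate on a
    -- ball of radius `s` then costs a factor `2 / s` per derivative.
    have hmaps : MapsTo (iteratedFDeriv ℂ k f) (ball x s)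
        (closedBall (iteratedFDeriv ℂ k f x) (2 * ((2 / s) ^ k * M))) := fun y hy => by
      rw [mem_closedBall, dist_eq_norm, two_mul]
      exact (norm_sub_le _ _).trans
        (add_le_add (ih y (hsub y hy)) (ih x (hsub x (mem_ball_self hs))))
    rw [← norm_fderiv_iteratedFDeriv]
    refine (Complex.norm_fderiv_le_div_of_mapsTo_ball hd hmaps hs).trans_eq ?_
    rw [pow_succ]
    ring

theorem IsHolo.clm_comp {F : Type*} [NormedAddCommGroup F] [NormedSpace ℂ F] (L : E →L[ℂ] F)
    {f : UnitBall X → E} (hf : IsHolo f) : IsHolo fun x => L (f x) :=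
  isHolo_of_agree (F := fun x => L (zeroExt f x))
    (fun x hx => (L.analyticAt _).comp (f := zeroExt f) (hf x hx)) fun x => by rw [zeroExt_apply]

theorem exists_closedBall_subset_unitBall {X : Type*} [NormedAddCommGroup X] (x : UnitBall X) :
    ∃ R : ℝ, 0 < R ∧ closedBall (x : X) R ⊆ ball 0 1 :=
  Metric.nhds_basis_closedBall.mem_iff.1 (isOpen_ball.mem_nhds x.2)

theorem norm_zeroExt_le (f : HInf X) (x : X) (hx : x ∈ ball (0 : X) 1) :
    ‖zeroExt f.1 x‖ ≤ ‖f‖ := by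
  rw [zeroExt_of_mem _ hx]
  exact HInf.norm_apply_le f _

theorem contDiffAt_zeroExt (f : HInf X) (x : UnitBall X) (n : WithTop ℕ∞) :
    ContDiffAt ℂ n (zeroExt f.1) x :=
  (f.2 x x.2).contDiffAt

/-- The Taylor coefficient of order `m` at a point of the ball. -/
noncomputable def taylorCoeff (x : UnitBall X) (m : ℕ) (f : HInf X) :
    ContinuousMultilinearMap ℂ (fun _ : Fin m => X) ℂ :=
  ((m.factorial : ℂ)⁻¹) • iteratedFDeriv ℂ m (zeroExt f.1) x

theorem norm_taylorCoeff_le (x : UnitBall X) {R : ℝ} (hR : 0 < R)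
    (hx : closedBall (x : X) R ⊆ ball 0 1) (m : ℕ) (f : HInf X) :
    ‖taylorCoeff x m f‖ ≤ (Real.exp 1 * (2 * Real.exp 1 / R) ^ m) * ‖f‖ := by
  -- With this step size, `m` successive estimates stay within radius `R`. The resulting factor `(m
  -- + 1) ^ m` is absorbed by `m!`, since `(m + 1) ^ m / m! ≤ exp (m + 1)`.
  have hs : 0 < R / (m + 1) := by positivity
  have h1 := norm_iteratedFDeriv_le_of_bounded isOpen_ball f.2 (norm_zeroExt_le f) hs m x
    ((closedBall_subset_closedBall (by
      rw [← mul_div_assoc, div_le_iff₀ (by positivity)]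
      nlinarith)).trans hx)
  have h2 := Real.pow_div_factorial_le_exp (x := (m : ℝ) + 1) (by positivity) m
  rw [taylorCoeff, norm_smul, norm_inv, Complex.norm_natCast]
  calc (m.factorial : ℝ)⁻¹ * ‖iteratedFDeriv ℂ m (zeroExt f.1) x‖
      ≤ (m.factorial : ℝ)⁻¹ * ((2 / (R / (m + 1))) ^ m * ‖f‖) := by gcongr
    _ = (((m : ℝ) + 1) ^ m / m.factorial) * (2 / R) ^ m * ‖f‖ := by
        rw [div_div_eq_mul_div, mul_div_right_comm, mul_pow]
        ring
    _ ≤ Real.exp (m + 1) * (2 / R) ^ m * ‖f‖ := by gcongr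
    _ = _ := by
        rw [Real.exp_add, ← Real.exp_one_pow m]
        rw [mul_div_right_comm, mul_pow]
        ring

theorem taylorCoeff_add (x : UnitBall X) (m : ℕ) (f g : HInf X) :
    taylorCoeff x m (f + g) = taylorCoeff x m f + taylorCoeff x m g := by
  have h : zeroExt (f + g).1 =ᶠ[𝓝 (x : X)] zeroExt f.1 + zeroExt g.1 := by
    filter_upwards [isOpen_ball.mem_nhds x.2] with y hy
    rw [Pi.add_apply, zeroExt_of_mem _ hy, zeroExt_of_mem _ hy, zeroExt_of_mem _ hy]
    rfl
  rw [taylorCoeff, (h.iteratedFDeriv ℂ m).eq_of_nhds,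
    iteratedFDeriv_add_apply (contDiffAt_zeroExt f x m) (contDiffAt_zeroExt g x m), smul_add]
  rfl

theorem taylorCoeff_smul (x : UnitBall X) (m : ℕ) (c : ℂ) (f : HInf X) :
    taylorCoeff x m (c • f) = c • taylorCoeff x m f := by
  have h : zeroExt (c • f).1 =ᶠ[𝓝 (x : X)] c • zeroExt f.1 := by
    filter_upwards [isOpen_ball.mem_nhds x.2] with y hy
    rw [Pi.smul_apply, zeroExt_of_mem _ hy, zeroExt_of_mem _ hy]
    rfl
  rw [taylorCoeff, (h.iteratedFDeriv ℂ m).eq_of_nhds,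
    iteratedFDeriv_const_smul_apply (contDiffAt_zeroExt f x m), smul_comm]
  rfl

/-- The Taylor coefficient as a bounded linear function of `f`. -/
theorem exists_taylorCoeffCLM (x : UnitBall X) {R : ℝ} (hR : 0 < R)
    (hx : closedBall (x : X) R ⊆ ball 0 1) (m : ℕ) :
    ∃ D : HInf X →L[ℂ] ContinuousMultilinearMap ℂ (fun _ : Fin m => X) ℂ,
      (∀ f, D f = taylorCoeff x m f) ∧ ‖D‖ ≤ Real.exp 1 * (2 * Real.exp 1 / R) ^ m :=
  ⟨LinearMap.mkContinuous
    { toFun := taylorCoeff x m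
      map_add' := taylorCoeff_add x m
      map_smul' := taylorCoeff_smul x m } _ (norm_taylorCoeff_le x hR hx m),
    fun _ => rfl, LinearMap.mkContinuous_norm_le _ (by positivity) _⟩

/-- Evaluation at a point of the ball. -/
noncomputable def evalAt (x : UnitBall X) : StrongDual ℂ (HInf X) :=
  LinearMap.mkContinuous
    { toFun := fun f => f.1 x
      map_add' := fun _ _ => rfl
      map_smul' := fun _ _ => rfl } 1
    fun f => (HInf.norm_apply_le f x).trans_eq (one_mul _).symm

/-- A map into a dual space is analytic at a point if it is pointwise analytic near it and its
Taylor coefficients there are geometrically bounded, uniformly on the unit ball of the predual. -/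
theorem analyticAt_of_pointwise {V : Type*} [NormedAddCommGroup V] [NormedSpace ℂ V]
    {ev : X → StrongDual ℂ V} {x₀ : X} {R C ρ : ℝ} (hR : 0 < R) (hC : 0 ≤ C) (hρ : 0 < ρ)
    (han : ∀ f, AnalyticOnNhd ℂ (fun x => ev x f) (ball x₀ R))
    (D : ∀ m : ℕ, V →L[ℂ] ContinuousMultilinearMap ℂ (fun _ : Fin m => X) ℂ)
    (hD : ∀ m f, D m f = ((m.factorial : ℂ)⁻¹) • iteratedFDeriv ℂ m (fun x => ev x f) x₀)
    (hDn : ∀ m, ‖D m‖ ≤ C * ρ ^ m) : AnalyticAt ℂ ev x₀ := by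
  let q : FormalMultilinearSeries ℂ X (StrongDual ℂ V) := fun m => (D m).flipMultilinear
  have hqn : ∀ m, ‖q m‖ ≤ C * ρ ^ m := fun m => by
    refine ContinuousMultilinearMap.opNorm_le_bound (by positivity) fun v => ?_
    refine ContinuousLinearMap.opNorm_le_bound _ (by positivity) fun f => ?_
    calc ‖D m f v‖ ≤ ‖D m f‖ * ∏ i, ‖v i‖ := (D m f).le_opNorm v
      _ ≤ (‖D m‖ * ‖f‖) * ∏ i, ‖v i‖ := by gcongr; exact (D m).le_opNorm f
      _ ≤ ((C * ρ ^ m) * ‖f‖) * ∏ i, ‖v i‖ := by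
        gcongr
        exact hDn m
      _ = _ := by ring
  obtain ⟨r, hr0, hrR, hrρ⟩ : ∃ r : NNReal, 0 < r ∧ (r : ℝ) ≤ R ∧ ρ * r ≤ 1 :=
    ⟨⟨min R ρ⁻¹, by positivity⟩, NNReal.coe_pos.1 (lt_min hR (inv_pos.2 hρ)), min_le_left _ _,
      (mul_le_mul_of_nonneg_left (min_le_right _ _) hρ.le).trans_eq (mul_inv_cancel₀ hρ.ne')⟩
  have hrad : (r : ENNReal) ≤ q.radius := by
    refine q.le_radius_of_bound C fun m => ?_
    calc ‖q m‖ * (r : ℝ) ^ m ≤ (C * ρ ^ m) * r ^ m := by gcongr; exact hqn m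
      _ = C * (ρ * r) ^ m := by rw [mul_pow]; ring
      _ ≤ C * 1 := by gcongr; exact pow_le_one₀ (by positivity) hrρ
      _ = C := mul_one C
  have hr0' : 0 < (r : ENNReal) := ENNReal.coe_pos.2 hr0
  have hq := (q.hasFPowerSeriesOnBall (hr0'.trans_le hrad)).mono hr0' hrad
  -- The Taylor series of `ev · f` is only known to converge to it on a ball depending on `f`. The
  -- identity theorem carries the equality to the ball of radius `r`, which is the same for all `f`.
  have key : ∀ f : V, EqOn (fun v => q.sum v f) (fun v => ev (x₀ + v) f) (ball 0 r) := by
    intro f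
    have h1 : AnalyticOnNhd ℂ (fun v => q.sum v f) (ball 0 r) := by
      have := hq.analyticOnNhd
      rw [eball_coe] at this
      exact fun v hv => ((ContinuousLinearMap.apply ℂ ℂ f).analyticAt _).comp (this v hv)
    have h2 : AnalyticOnNhd ℂ (fun v => ev (x₀ + v) f) (ball 0 r) := fun v hv =>
      (han f (x₀ + v) (by
        rw [mem_ball, dist_eq_norm, add_sub_cancel_left]
        exact (mem_ball_zero_iff.1 hv).trans_le hrR)).comp_of_eq
          (analyticAt_const.add analyticAt_id) rfl
    refine h1.eqOn_of_preconnected_of_eventuallyEq h2 (convex_ball _ _).isPreconnected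
      (mem_ball_self hr0) ?_
    obtain ⟨p, σ, hp⟩ := han f x₀ (mem_ball_self hR)
    filter_upwards [Metric.eball_mem_nhds (0 : X) hp.r_pos,
      Metric.eball_mem_nhds (0 : X) hr0'] with v hv hv'
    have hs := hp.hasSum_iteratedFDeriv hv
    have hs' := (ContinuousLinearMap.apply ℂ ℂ f).hasSum (hq.hasSum hv')
    rw [zero_add] at hs'
    refine hs'.unique (hs.congr_fun ?_)
    intro m
    change D m f (fun _ => v) = _
    rw [hD]
    rfl
  have hev : ev =ᶠ[𝓝 x₀] fun y => q.sum (y - x₀) := by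
    filter_upwards [ball_mem_nhds x₀ (NNReal.coe_pos.2 hr0)] with y hy
    ext f
    have := key f (mem_ball_zero_iff.2 (by rw [← dist_eq_norm]; exact hy) : y - x₀ ∈ ball 0 (r : ℝ))
    simp only [add_sub_cancel] at this
    exact this.symm
  have h0 : AnalyticAt ℂ q.sum (x₀ - x₀) := by rw [sub_self]; exact hq.analyticAt
  exact (h0.comp (f := fun y => y - x₀) (analyticAt_id.sub analyticAt_const)).congr hev.symm

/-- The evaluation map of the ball into the dual of the algebra is holomorphic. -/
theorem isHolo_evalAt : IsHolo (evalAt : UnitBall X → StrongDual ℂ (HInf X)) := by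
  intro x₀ hx₀
  obtain ⟨R, hR, hsub⟩ := exists_closedBall_subset_unitBall ⟨x₀, hx₀⟩
  choose D hD hDn using exists_taylorCoeffCLM (⟨x₀, hx₀⟩ : UnitBall X) hR hsub
  have hext : ∀ f : HInf X, EqOn (zeroExt f.1) (fun x => zeroExt evalAt x f) (ball 0 1) :=
    fun f x hx => by
      simp only [zeroExt_of_mem _ hx]
      rfl
  refine analyticAt_of_pointwise hR (Real.exp_pos 1).le (ρ := 2 * Real.exp 1 / R) (by positivity)
    (fun f => (f.2.congr isOpen_ball (hext f)).mono (ball_subset_closedBall.trans hsub))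
    D (fun m f => ?_) hDn
  rw [hD, taylorCoeff, (((hext f).eventuallyEq_of_mem
    (isOpen_ball.mem_nhds hx₀)).iteratedFDeriv ℂ m).eq_of_nhds]

/-- A Cauchy sequence in the algebra converges in its bidual, which is always complete, to some `ℓ`.
The uniform limit is then `x ↦ ℓ (evalAt x)`, holomorphic because `evalAt` is. -/
theorem isClosed_HInf : IsClosed (HInf X : Set (UnitBall X →ᵇ ℂ)) := by
  refine IsSeqClosed.isClosed fun u F hu hF => ?_
  let v : ℕ → HInf X := fun n => ⟨u n, hu n⟩
  have hv : CauchySeq v := by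
    refine Metric.cauchySeq_iff.2 fun ε hε => ?_
    exact Metric.cauchySeq_iff.1 hF.cauchySeq ε hε
  obtain ⟨ℓ, hℓ⟩ := cauchySeq_tendsto_of_complete
    ((NormedSpace.inclusionInDoubleDual ℂ (HInf X)).uniformContinuous.comp_cauchySeq hv)
  refine isHolo_of_agree (F := zeroExt fun x : UnitBall X => ℓ (evalAt x))
    (isHolo_evalAt.clm_comp ℓ) fun x => ?_
  rw [zeroExt_apply]
  have h1 : Filter.Tendsto (fun n => u n x) Filter.atTop (𝓝 (ℓ (evalAt x))) :=
    ((ContinuousLinearMap.apply ℂ ℂ (evalAt x)).continuous.tendsto ℓ).comp hℓ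
  have h2 : Filter.Tendsto (fun n => u n x) Filter.atTop (𝓝 (F x)) :=
    (BoundedContinuousFunction.tendsto_iff_tendstoUniformly.1 hF).tendsto_at x
  exact tendsto_nhds_unique h1 h2

instance : CompleteSpace (HInf X) :=
  isClosed_HInf.completeSpace_coe

end Cauchy
-- Goldstine's theorem and characters over points of the bidual ball
section Characters

variable {X : Type*} [NormedAddCommGroup X] [NormedSpace ℂ X]

/-- The ball is invariant under unimodular scalars, and a suitable one turns `φ x` into its modulus;
so real parts control the norm. -/
theorem norm_le_of_re_lt {φ : StrongDual ℂ X} {u : ℝ} (h : ∀ x : UnitBall X, (φ x).re < u) :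
    ‖φ‖ ≤ u := by
  rw [← φ.sSup_unit_ball_eq_norm]
  refine csSup_le ((nonempty_ball.2 one_pos).image _) ?_
  rintro _ ⟨x, hx, rfl⟩
  by_cases h0 : φ x = 0
  · have := h ⟨0, mem_ball_self one_pos⟩
    simp only [map_zero, Complex.zero_re] at this
    simpa [h0] using this.le
  · have hc : ‖(‖φ x‖ : ℂ) / φ x‖ = 1 := by
      rw [norm_div, Complex.norm_real, norm_norm, div_self (norm_ne_zero_iff.2 h0)]
    have := h ⟨((‖φ x‖ : ℂ) / φ x) • x, by
      rw [mem_ball_zero_iff, norm_smul, hc, one_mul]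
      exact mem_ball_zero_iff.1 hx⟩
    simp only [map_smul, smul_eq_mul, div_mul_cancel₀ _ h0, Complex.ofReal_re] at this
    exact this.le

/-- A point which cannot be separated from a convex set belongs to its weak closure. -/
theorem mem_closure_of_forall_re_le {E F : Type*} [AddCommGroup E] [Module ℂ E] [Module ℝ E]
    [IsScalarTower ℝ ℂ E] [AddCommGroup F] [Module ℂ F] (B : E →ₗ[ℂ] F →ₗ[ℂ] ℂ) {s : Set E}
    (hs : Convex ℝ s) {z : E}
    (h : ∀ (φ : F) (u : ℝ), (∀ a ∈ s, (B a φ).re < u) → (B z φ).re ≤ u) :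
    (fun φ => B z φ) ∈ closure ((fun w φ => B w φ) '' s) := by
  let s' : Set (WeakBilin B) := s
  let z' : WeakBilin B := z
  have key : z' ∈ closure s' := by
    have hs' : Convex ℝ s' := hs
    have hc : ContinuousSMul ℝ (WeakBilin B) := IsScalarTower.continuousSMul (M := ℝ) ℂ
    by_contra hcon
    obtain ⟨f, u, hu, huz⟩ := RCLike.geometric_hahn_banach_closed_point (𝕜 := ℂ)
      hs'.closure isClosed_closure hcon
    -- Every functional continuous for the weak topology of the pairing is the pairing with some
    -- element of `F`.
    obtain ⟨φ, rfl⟩ := LinearMap.dualEmbedding_surjective B f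
    exact not_le.2 huz (h φ u fun a ha => hu a (subset_closure ha))
  exact (closure_induced (f := fun (w : E) (φ : F) => B w φ)).1 key

/-- **Goldstine's theorem.** -/
theorem mem_closure_range_eval (z : Bidual X) (hz : ‖z‖ ≤ 1) :
    (fun φ => z φ) ∈ closure (range fun (x : UnitBall X) (φ : StrongDual ℂ X) => φ x) := by
  let j := (NormedSpace.inclusionInDoubleDual ℂ X).restrictScalars ℝ
  have h1 := mem_closure_of_forall_re_le
    (ContinuousLinearMap.coeLM ℂ : Bidual X →ₗ[ℂ] StrongDual ℂ X →ₗ[ℂ] ℂ)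
    ((convex_ball (0 : X) 1).linear_image j.toLinearMap) (z := z) fun φ u hu => by
      have h1 : ‖φ‖ ≤ u := norm_le_of_re_lt fun x => hu _ ⟨x, x.2, rfl⟩
      have h3 : ‖z φ‖ ≤ 1 * ‖φ‖ := z.le_of_opNorm_le hz φ
      change (z φ).re ≤ u
      linarith [Complex.re_le_norm (z φ)]
  refine closure_mono ?_ h1
  rintro _ ⟨_, ⟨x, hx, rfl⟩, rfl⟩
  exact ⟨⟨x, hx⟩, rfl⟩

/-- Goldstine provides a filter on the ball along which every functional `φ` tends to `z φ`. Along a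
finer ultrafilter each bounded `f` has a limit, and limits respect the algebra operations and the
norm bound. -/
theorem exists_character (z : BidualBall X) :
    ∃ χ : HInf X →ₐ[ℂ] ℂ, (∀ f, ‖χ f‖ ≤ ‖f‖) ∧ ∀ φ, χ (linFun φ) = z.1 φ := by
  let e : UnitBall X → StrongDual ℂ X → ℂ := fun x φ => φ x
  have hne : (Filter.comap e (𝓝 fun φ => z.1 φ)).NeBot := by
    have h := mem_closure_range_eval (WeakDual.toStrongDual z.1) z.2
    rw [mem_closure_iff_nhds] at h
    refine Filter.comap_neBot fun t ht => ?_
    obtain ⟨_, hat, x, rfl⟩ := h t ht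
    exact ⟨x, hat⟩
  let U := Ultrafilter.of (Filter.comap e (𝓝 fun φ => z.1 φ))
  have hlim : ∀ f : HInf X, ∃ c, ‖c‖ ≤ ‖f‖ ∧ Filter.Tendsto f.1 U (𝓝 c) := fun f => by
    obtain ⟨c, hc, hc'⟩ := (isCompact_closedBall (0 : ℂ) ‖f‖).ultrafilter_le_nhds (U.map f.1)
      (Filter.le_principal_iff.2 (Filter.mem_map.2 <| Filter.univ_mem' fun x =>
        mem_closedBall_zero_iff.2 (HInf.norm_apply_le f x)))
    exact ⟨c, mem_closedBall_zero_iff.1 hc, hc'⟩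
  choose χ hχn hχ using hlim
  refine ⟨{ toFun := χ
            map_one' := tendsto_nhds_unique (hχ 1) tendsto_const_nhds
            map_mul' := fun f g => tendsto_nhds_unique (hχ (f * g)) ((hχ f).mul (hχ g))
            map_zero' := tendsto_nhds_unique (hχ 0) tendsto_const_nhds
            map_add' := fun f g => tendsto_nhds_unique (hχ (f + g)) ((hχ f).add (hχ g))
            commutes' := fun c =>
              tendsto_nhds_unique (hχ (algebraMap ℂ _ c)) tendsto_const_nhds }, hχn, fun φ => ?_⟩
  have h1 : Filter.Tendsto e (U : Filter (UnitBall X)) (𝓝 fun φ => z.1 φ) :=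
    Filter.tendsto_comap.mono_left (Ultrafilter.of_le _)
  exact tendsto_nhds_unique (hχ (linFun φ)) (tendsto_pi_nhds.1 h1 φ)

/-- A character of the algebra lying over a point of the closed unit ball of the bidual. -/
noncomputable def character (z : BidualBall X) : HInf X →ₐ[ℂ] ℂ := (exists_character z).choose

theorem norm_character_le (z : BidualBall X) (f : HInf X) : ‖character z f‖ ≤ ‖f‖ :=
  (exists_character z).choose_spec.1 f

theorem character_linFun (z : BidualBall X) (φ : StrongDual ℂ X) :
    character z (linFun φ) = z.1 φ :=
  (exists_character z).choose_spec.2 φ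

theorem continuous_of_norm_apply_le {χ : HInf X →ₐ[ℂ] ℂ} (hχ : ∀ f, ‖χ f‖ ≤ ‖f‖) : Continuous χ :=
  AddMonoidHomClass.continuous_of_bound χ 1 fun f => (hχ f).trans_eq (one_mul _).symm

/-- The closed subalgebra generated by the continuous linear functionals. -/
noncomputable def linAlg (X : Type*) [NormedAddCommGroup X] [NormedSpace ℂ X] :
    Subalgebra ℂ (HInf X) :=
  (Algebra.adjoin ℂ (range linFun)).topologicalClosure

theorem linAlg_le {S : Subalgebra ℂ (HInf X)} (hS : IsClosed (S : Set (HInf X)))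
    (h : ∀ φ, linFun φ ∈ S) : linAlg X ≤ S :=
  Subalgebra.topologicalClosure_minimal (Algebra.adjoin_le (range_subset_iff.2 h)) hS

theorem closure_finiteTypePoly_subset :
    closure (finiteTypePoly X : Set (HInf X)) ⊆ linAlg X := by
  refine closure_minimal (fun p hp => ?_) (Subalgebra.isClosed_topologicalClosure _)
  have : finiteTypePoly X ≤ (linAlg X).toSubmodule := by
    refine Submodule.span_le.2 ?_
    rintro _ ⟨φ, m, rfl⟩
    exact (linAlg X).pow_mem
      (Subalgebra.le_topologicalClosure _ (Algebra.subset_adjoin ⟨φ, rfl⟩)) m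
  exact this hp

/-- The set where two continuous characters agree is a closed subalgebra. This makes the arbitrary
choice in `character` harmless on `linAlg X`. -/
theorem character_eq_of_linFun {χ ψ : HInf X →ₐ[ℂ] ℂ} (hχ : ∀ f, ‖χ f‖ ≤ ‖f‖)
    (hψ : ∀ f, ‖ψ f‖ ≤ ‖f‖) (h : ∀ φ, χ (linFun φ) = ψ (linFun φ)) {f : HInf X}
    (hf : f ∈ linAlg X) : χ f = ψ f :=
  linAlg_le (S := AlgHom.equalizer χ ψ)
    (isClosed_eq (continuous_of_norm_apply_le hχ) (continuous_of_norm_apply_le hψ)) h hf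

theorem norm_character_sub_le (z : BidualBall X) (f g : HInf X) :
    ‖character z f - character z g‖ ≤ ‖f - g‖ := by
  rw [← map_sub]
  exact norm_character_le z _

/-- On the algebra generated by the linear functionals, the character depends continuously on
the point. -/
theorem continuous_character {f : HInf X} (hf : f ∈ linAlg X) :
    Continuous fun z : BidualBall X => character z f := by
  let S : Subalgebra ℂ (HInf X) :=
    { carrier := {f | Continuous fun z : BidualBall X => character z f}
      add_mem' := fun hf hg => by simpa using Continuous.fun_add hf hg
      mul_mem' := fun hf hg => by simpa using Continuous.fun_mul hf hg
      algebraMap_mem' := fun c => by simpa using continuous_const }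
  refine linAlg_le (S := S) (isClosed_of_closure_subset fun f hf => ?_) (fun φ => ?_) hf
  -- Contractivity of every `character z` makes approximation in the algebra uniform in `z`.
  · refine continuous_of_uniform_approx_of_continuous fun u hu => ?_
    obtain ⟨ε, hε, hεu⟩ := Metric.mem_uniformity_dist.1 hu
    obtain ⟨g, hg, hfg⟩ := Metric.mem_closure_iff.1 hf ε hε
    refine ⟨fun z => character z g, hg, fun z => hεu ?_⟩
    rw [dist_eq_norm] at hfg ⊢
    exact (norm_character_sub_le z f g).trans_lt hfg
  · change Continuous fun z : BidualBall X => character z (linFun φ)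
    simp only [character_linFun]
    exact (WeakDual.eval_continuous φ).comp continuous_subtype_val

variable {Y : Type*} [NormedAddCommGroup Y] [NormedSpace ℂ Y]

theorem HInf.norm_le_of_forall {F : HInf Y} {C : ℝ} (hC : 0 ≤ C) (h : ∀ y, ‖F.1 y‖ ≤ C) :
    ‖F‖ ≤ C :=
  (BoundedContinuousFunction.norm_le (f := F.1) hC).2 h

/-- Composition of a bounded holomorphic map into the bidual with the extension of a function in
the algebra generated by the linear functionals is holomorphic. -/
theorem exists_character_comp (g : HInfVec Y (Bidual X)) (hg : ‖g‖ ≤ 1) {f : HInf X}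
    (hf : f ∈ linAlg X) :
    ∃ F : HInf Y, ∀ y, F.1 y = character (valueInBall g hg y) f := by
  let S : Subalgebra ℂ (HInf X) :=
    { carrier := {f | ∃ F : HInf Y, ∀ y, F.1 y = character (valueInBall g hg y) f}
      add_mem' := by
        rintro f₁ f₂ ⟨F₁, h₁⟩ ⟨F₂, h₂⟩
        exact ⟨F₁ + F₂, fun y => by rw [map_add, ← h₁, ← h₂]; rfl⟩
      mul_mem' := by
        rintro f₁ f₂ ⟨F₁, h₁⟩ ⟨F₂, h₂⟩
        exact ⟨F₁ * F₂, fun y => by rw [map_mul, ← h₁, ← h₂]; rfl⟩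
      algebraMap_mem' := fun c => ⟨algebraMap ℂ _ c, fun y => by rw [AlgHom.commutes]; rfl⟩ }
  refine linAlg_le (S := S) (IsSeqClosed.isClosed fun u f hu hf => ?_) (fun φ => ?_) hf
  -- Contractivity of the characters gives `‖F m - F n‖ ≤ ‖u m - u n‖`, so the compositions converge
  -- in the complete space `HInf Y`.
  · choose F hF using hu
    have hcau : CauchySeq F := by
      refine Metric.cauchySeq_iff.2 fun ε hε => ?_
      obtain ⟨N, hN⟩ := Metric.cauchySeq_iff.1 hf.cauchySeq ε hε
      refine ⟨N, fun m hm n hn => (le_trans ?_ le_rfl).trans_lt (hN m hm n hn)⟩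
      rw [dist_eq_norm, dist_eq_norm]
      refine HInf.norm_le_of_forall (norm_nonneg _) fun y => ?_
      change ‖(F m).1 y - (F n).1 y‖ ≤ _
      rw [hF, hF]
      exact norm_character_sub_le _ _ _
    obtain ⟨G, hG⟩ := cauchySeq_tendsto_of_complete hcau
    refine ⟨G, fun y => ?_⟩
    have h1 : Filter.Tendsto (fun n => (F n).1 y) Filter.atTop (𝓝 (G.1 y)) :=
      ((evalAt y).continuous.tendsto G).comp hG
    simp only [hF] at h1
    exact tendsto_nhds_unique h1
      (((continuous_of_norm_apply_le (norm_character_le _)).tendsto f).comp hf)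
  · let ev : Bidual X →L[ℂ] ℂ := ContinuousLinearMap.apply ℂ ℂ φ
    refine ⟨⟨BoundedContinuousFunction.ofNormedAddCommGroup (fun y => ev (g.1 y))
      (ev.continuous.comp g.1.continuous) ‖φ‖ fun y => ?_, ?_⟩, fun y => ?_⟩
    · exact ((g.1 y).le_of_opNorm_le ((g.1.norm_coe_le_norm y).trans hg) φ).trans_eq (one_mul _)
    · exact IsHolo.clm_comp ev g.2
    · rw [character_linFun]; rfl

end Characters
-- Comparison of the canonical extension with characters
section CanonicalExtensionLemmas

variable {X : Type*} [NormedAddCommGroup X] [NormedSpace ℂ X]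

/-- Freezing the first variable leaves a form of the same kind with constant `c * φ x₀`, so the
outer functional `z 0` is applied to a multiple of `φ`. The free constant `c` is what lets the
induction close. -/
theorem arensExt_of_eq_prod (φ : StrongDual ℂ X) (m : ℕ) :
    ∀ (z : Fin m → Bidual X) (A : ContinuousMultilinearMap ℂ (fun _ : Fin m => X) ℂ) (c : ℂ),
      (∀ x, A x = c * ∏ i, φ (x i)) → arensExt m z A = c * ∏ i, z i φ := by
  induction m with
  | zero =>
    intro z A c h
    simpa [arensExt] using h 0
  | succ m ih =>
    intro z A c h
    have h1 : (ContinuousLinearMap.compL ℂ X _ ℂ (arensExt m (Fin.tail z)))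
        (continuousMultilinearCurryLeftEquiv ℂ (fun _ : Fin (m + 1) => X) ℂ A)
        = (c * ∏ i, Fin.tail z i φ) • φ := by
      ext x₀
      change arensExt m (Fin.tail z) (A.curryLeft x₀) = (c * ∏ i, Fin.tail z i φ) * φ x₀
      rw [ih (Fin.tail z) (A.curryLeft x₀) (c * φ x₀) fun x => ?_]
      · ring
      · change A (Fin.cons x₀ x) = _
        rw [h, Fin.prod_univ_succ]
        simp [mul_assoc]
    change z 0 ((ContinuousLinearMap.compL ℂ X _ ℂ (arensExt m (Fin.tail z)))
        (continuousMultilinearCurryLeftEquiv ℂ (fun _ : Fin (m + 1) => X) ℂ A)) = _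
    rw [h1, map_smul, Fin.prod_univ_succ, smul_eq_mul]
    simp only [Fin.tail]
    ring

theorem taylorForm_linFun_pow (φ : StrongDual ℂ X) (k m : ℕ) (x : Fin m → X) :
    taylorForm (linFun φ ^ k) m x = (if m = k then 1 else 0) * ∏ i, φ (x i) := by
  have h : zeroExt (linFun φ ^ k).1 =ᶠ[𝓝 (0 : X)] (fun t : ℂ => t ^ k) ∘ φ := by
    filter_upwards [ball_mem_nhds (0 : X) one_pos] with y hy
    rw [zeroExt_of_mem _ hy]
    rfl
  rw [taylorForm, (h.iteratedFDeriv ℂ m).eq_of_nhds,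
    φ.iteratedFDeriv_comp_right (n := m) (f := fun t : ℂ => t ^ k) (contDiff_id.pow k) 0 le_rfl]
  simp only [smul_apply, map_zero,
    ContinuousMultilinearMap.compContinuousLinearMap_apply, smul_eq_mul,
    iteratedFDeriv_apply_eq_iteratedDeriv_mul_prod, iteratedDeriv_fun_pow_zero]
  split_ifs with hmk
  · subst hmk
    field_simp [Nat.cast_ne_zero.2 m.factorial_ne_zero]
  · simp

/-- The `m`-th Taylor polynomial of `f` at the origin, extended to the bidual. -/
theorem exists_extTaylor (z : Bidual X) (m : ℕ) :
    ∃ D : HInf X →L[ℂ] ℂ, ∀ f, D f = arensExt m (fun _ => z) (taylorForm f m) := by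
  obtain ⟨R, hR, hsub⟩ := exists_closedBall_subset_unitBall
    (⟨0, mem_ball_self one_pos⟩ : UnitBall X)
  obtain ⟨D, hD, -⟩ := exists_taylorCoeffCLM _ hR hsub m
  exact ⟨(arensExt m fun _ => z).comp D, fun f => congrArg _ (hD f)⟩

/-- The `m`-th Taylor polynomial at the origin, extended to the bidual, as a continuous linear
functional. -/
noncomputable def extTaylor (z : Bidual X) (m : ℕ) : HInf X →L[ℂ] ℂ :=
  (exists_extTaylor z m).choose

theorem extTaylor_apply (z : Bidual X) (m : ℕ) (f : HInf X) :
    extTaylor z m f = arensExt m (fun _ => z) (taylorForm f m) :=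
  (exists_extTaylor z m).choose_spec f

theorem extTaylor_linFun_pow (z : Bidual X) (m k : ℕ) (φ : StrongDual ℂ X) :
    extTaylor z m (linFun φ ^ k) = if m = k then z φ ^ k else 0 := by
  rw [extTaylor_apply, arensExt_of_eq_prod φ m _ _ _ (taylorForm_linFun_pow φ k m)]
  split_ifs with h
  · simp [h]
  · simp

/-- Both sides are linear and continuous in `f`, so it is enough to check powers of functionals. -/
theorem extTaylor_smul {f : HInf X} (hf : f ∈ closure (finiteTypePoly X : Set (HInf X))) (m : ℕ)
    (t : ℂ) (z : Bidual X) : extTaylor (t • z) m f = t ^ m * extTaylor z m f := by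
  have hcl : IsClosed {f : HInf X | extTaylor (t • z) m f = (t ^ m • extTaylor z m) f} :=
    isClosed_eq (extTaylor (t • z) m).continuous (t ^ m • extTaylor z m).continuous
  refine closure_minimal (fun p hp => ?_) hcl hf
  refine LinearMap.eqOn_span (f := (extTaylor (t • z) m).toLinearMap)
    (g := (t ^ m • extTaylor z m).toLinearMap) ?_ hp
  rintro _ ⟨φ, k, rfl⟩
  change extTaylor (t • z) m (linFun φ ^ k) = t ^ m * extTaylor z m (linFun φ ^ k)
  rw [extTaylor_linFun_pow, extTaylor_linFun_pow]
  split_ifs with h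
  · rw [h, smul_apply, smul_eq_mul, mul_pow]
  · rw [mul_zero]

/-- A point of the closed ball of the bidual. -/
noncomputable def ballPoint (z : Bidual X) (hz : ‖z‖ ≤ 1) : BidualBall X :=
  ⟨StrongDual.toWeakDual z, hz⟩

theorem character_ballPoint_linFun (z : Bidual X) (hz : ‖z‖ ≤ 1) (φ : StrongDual ℂ X) :
    character (ballPoint z hz) (linFun φ) = z φ :=
  character_linFun _ φ

/-- Along the complex line through `z`, the extension of a finite type polynomial is a polynomial in
one variable. This links the two descriptions: its coefficients are the extended Taylor terms, its
values are given by characters. -/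
theorem exists_polynomial (z : Bidual X) {p : HInf X} (hp : p ∈ finiteTypePoly X) :
    ∃ P : Polynomial ℂ, (∀ m, P.coeff m = extTaylor z m p) ∧
      ∀ (t : ℂ) (h : ‖t • z‖ ≤ 1), P.eval t = character (ballPoint (t • z) h) p := by
  induction hp using Submodule.span_induction with
  | mem p hp =>
    obtain ⟨φ, k, rfl⟩ := hp
    refine ⟨Polynomial.monomial k (z φ ^ k), fun m => ?_, fun t h => ?_⟩
    · rw [extTaylor_linFun_pow, Polynomial.coeff_monomial]
      simp only [eq_comm]
    · rw [map_pow (character _), character_ballPoint_linFun, Polynomial.eval_monomial,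
        smul_apply, smul_eq_mul, mul_pow, mul_comm]
  | zero => exact ⟨0, by simp, by simp⟩
  | add p q _ _ hp hq =>
    obtain ⟨P, hP, hP'⟩ := hp
    obtain ⟨Q, hQ, hQ'⟩ := hq
    refine ⟨P + Q, fun m => ?_, fun t h => ?_⟩
    · rw [Polynomial.coeff_add, hP, hQ, map_add]
    · rw [Polynomial.eval_add, hP' t h, hQ' t h, map_add]
  | smul c p _ hp =>
    obtain ⟨P, hP, hP'⟩ := hp
    refine ⟨c • P, fun m => ?_, fun t h => ?_⟩
    · rw [Polynomial.coeff_smul, hP, map_smul]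
    · rw [Polynomial.eval_smul, hP' t h, map_smul]

/-- Cauchy's estimate for the coefficients of a polynomial. -/
theorem norm_coeff_le_of_circle (P : Polynomial ℂ) {C : ℝ} (hC : 0 ≤ C)
    (h : ∀ t : ℂ, ‖t‖ = 1 → ‖P.eval t‖ ≤ C) (m : ℕ) : ‖P.coeff m‖ ≤ C := by
  refine le_of_sq_le_sq ?_ hC
  by_cases hm : m ∈ P.support
  -- Parseval: the sum of the squared coefficients is the mean of `‖P‖ ^ 2` over the unit circle.
  · calc ‖P.coeff m‖ ^ 2 ≤ ∑ i ∈ P.support, ‖P.coeff i‖ ^ 2 :=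
        Finset.single_le_sum (f := fun i => ‖P.coeff i‖ ^ 2) (fun i _ => by positivity) hm
      _ = Real.circleAverage (fun t => ‖P.eval t‖ ^ 2) 0 1 := P.sum_sq_norm_coeff_eq_circleAverage
      _ ≤ C ^ 2 := by
        refine Real.circleAverage_mono_on_of_le_circle
          (ContinuousOn.circleIntegrable' (by fun_prop)) fun t ht => ?_
        have := h t (by simpa using ht)
        gcongr
  · rw [Polynomial.notMem_support_iff.1 hm]
    simpa using sq_nonneg C

/-- The bound comes from Cauchy's estimate on the circle `t • z`. Its constant is 1 for every `m`,
unlike the geometrically growing bound on `taylorCoeff`; this provides the dominating series for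
passing to uniform limits. -/
theorem norm_extTaylor_le {z : Bidual X} (hz : ‖z‖ ≤ 1) (m : ℕ) {p : HInf X}
    (hp : p ∈ finiteTypePoly X) : ‖extTaylor z m p‖ ≤ ‖p‖ := by
  obtain ⟨P, hP, hP'⟩ := exists_polynomial z hp
  rw [← hP]
  refine norm_coeff_le_of_circle P (norm_nonneg p) (fun t ht => ?_) m
  rw [hP' t (by rw [norm_smul, ht, one_mul]; exact hz)]
  exact norm_character_le _ _

theorem hasSum_extTaylor (z : Bidual X) {p : HInf X} (hp : p ∈ finiteTypePoly X)
    (t : ℂ) (h : ‖t • z‖ ≤ 1) :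
    HasSum (fun m => t ^ m * extTaylor z m p) (character (ballPoint (t • z) h) p) := by
  obtain ⟨P, hP, hP'⟩ := exists_polynomial z hp
  rw [← hP' t h, Polynomial.eval_eq_sum_range]
  simp only [← hP]
  simp only [mul_comm (t ^ _)]
  refine hasSum_sum_of_ne_finset_zero fun m hm => ?_
  rw [Polynomial.coeff_eq_zero_of_natDegree_lt (by simpa using hm), zero_mul]

/-- On uniform limits of finite type polynomials, the canonical extension is given by the
characters. -/
theorem canonicalExt_eq_character {f : HInf X}
    (hf : f ∈ closure (finiteTypePoly X : Set (HInf X))) (z : BidualBall X)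
    (hz : ‖WeakDual.toStrongDual z.1‖ < 1) :
    canonicalExt f (WeakDual.toStrongDual z.1) = character z f := by
  -- Write `z = r • w` with `‖w‖ ≤ 1` and `r < 1`: homogeneity then gives the `m`-th term a factor
  -- `r ^ m`, and dominated convergence applies with a geometric series.
  obtain ⟨r, hzr, hr1⟩ := exists_between hz
  have hr0 : 0 < r := (norm_nonneg (WeakDual.toStrongDual z.1 : Bidual X)).trans_lt hzr
  set w : Bidual X := (r : ℂ)⁻¹ • WeakDual.toStrongDual z.1 with hw
  have hrw : (r : ℂ) • w = WeakDual.toStrongDual z.1 :=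
    smul_inv_smul₀ (Complex.ofReal_ne_zero.2 hr0.ne') _
  have hw1 : ‖w‖ ≤ 1 := by
    rw [hw, norm_smul, norm_inv, Complex.norm_real, Real.norm_of_nonneg hr0.le,
      inv_mul_le_iff₀ hr0, mul_one]
    exact hzr.le
  have hrw1 : ‖(r : ℂ) • w‖ ≤ 1 := hrw ▸ hz.le
  have hzeq : ballPoint ((r : ℂ) • w) hrw1 = z := Subtype.ext (by
    change StrongDual.toWeakDual ((r : ℂ) • w) = z.1
    rw [hrw]; rfl)
  obtain ⟨u, hu, huf⟩ := mem_closure_iff_seq_limit.1 hf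
  have h1 : Filter.Tendsto (fun n => ∑' m, (r : ℂ) ^ m * extTaylor w m (u n)) Filter.atTop
      (𝓝 (∑' m, (r : ℂ) ^ m * extTaylor w m f)) := by
    refine tendsto_tsum_of_dominated_convergence (bound := fun m => r ^ m * (‖f‖ + 1))
      ((summable_geometric_of_lt_one hr0.le hr1).mul_right _)
      (fun m => (((extTaylor w m).continuous.tendsto f).comp huf).const_mul _) ?_
    filter_upwards [huf.norm.eventually (gt_mem_nhds (lt_add_one ‖f‖))] with n hn m
    rw [norm_mul, norm_pow, Complex.norm_real, Real.norm_of_nonneg hr0.le]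
    gcongr
    exact (norm_extTaylor_le hw1 m (hu n)).trans hn.le
  have h2 : Filter.Tendsto (fun n => character z (u n)) Filter.atTop (𝓝 (character z f)) :=
    ((continuous_of_norm_apply_le (norm_character_le z)).tendsto f).comp huf
  have h3 : (fun n => ∑' m, (r : ℂ) ^ m * extTaylor w m (u n)) = fun n => character z (u n) := by
    funext n
    rw [(hasSum_extTaylor w (hu n) r hrw1).tsum_eq, hzeq]
  rw [h3] at h1
  rw [← tendsto_nhds_unique h1 h2, canonicalExt]
  refine tsum_congr fun m => ?_
  rw [← extTaylor_smul hf, hrw, extTaylor_apply]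

end CanonicalExtensionLemmas
-- The isometry, the extension of an automorphism, and the fibers
section Automorphisms

variable {X Y : Type*} [NormedAddCommGroup X] [NormedSpace ℂ X]
  [NormedAddCommGroup Y] [NormedSpace ℂ Y]

theorem BallAut.comp_symm_comp (θ : BallAut X) (f : HInf X) : θ.comp (θ.symm.comp f) = f :=
  HInf.ext' fun x => congrArg f.1 (θ.toEquiv.symm_apply_apply x)

theorem BallAut.symm_comp_comp (θ : BallAut X) (f : HInf X) : θ.symm.comp (θ.comp f) = f :=
  HInf.ext' fun x => congrArg f.1 (θ.toEquiv.apply_symm_apply x)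

theorem BallAut.norm_comp_le (θ : BallAut X) (f : HInf X) : ‖θ.comp f‖ ≤ ‖f‖ :=
  HInf.norm_le_of_forall (norm_nonneg f) fun _ => HInf.norm_apply_le f _

theorem Lam_toHom (θ : BallAut X) (Φ : MInf X Y) (f : HInf X) :
    (Lam θ Φ).toHom f = Φ.toHom (θ.comp f) := rfl

theorem Lam_Lam_symm (θ : BallAut X) (Φ : MInf X Y) : Lam θ (Lam θ.symm Φ) = Φ :=
  MInf.ext' fun f => by rw [Lam_toHom, Lam_toHom, θ.symm_comp_comp]

theorem Lam_symm_Lam (θ : BallAut X) (Φ : MInf X Y) : Lam θ.symm (Lam θ Φ) = Φ :=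
  MInf.ext' fun f => by rw [Lam_toHom, Lam_toHom, θ.comp_symm_comp]

theorem dist_Lam_le (θ : BallAut X) (Φ Ψ : MInf X Y) : dist (Lam θ Φ) (Lam θ Ψ) ≤ dist Φ Ψ := by
  rw [MInf.dist_eq, MInf.dist_eq]
  refine ContinuousLinearMap.opNorm_le_bound _ (norm_nonneg _) fun f => ?_
  exact ((Φ.toCLM - Ψ.toCLM).le_opNorm (θ.comp f)).trans
    (mul_le_mul_of_nonneg_left (θ.norm_comp_le f) (norm_nonneg _))

theorem isometry_Lam (θ : BallAut X) : Isometry (Lam θ : MInf X Y → MInf X Y) :=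
  Isometry.of_dist_eq fun Φ Ψ => (dist_Lam_le θ Φ Ψ).antisymm (by
    simpa only [Lam_symm_Lam] using dist_Lam_le θ.symm (Lam θ Φ) (Lam θ Ψ))

theorem bijective_Lam (θ : BallAut X) : Function.Bijective (Lam θ : MInf X Y → MInf X Y) :=
  Function.bijective_iff_has_inverse.2 ⟨Lam θ.symm, Lam_symm_Lam θ, Lam_Lam_symm θ⟩

/-- A non-null algebra homomorphism is automatically unital, since the ball is connected. -/
theorem MInf.map_one (Φ : MInf X Y) : Φ.toHom 1 = 1 := by
  have hidem : ∀ y, (Φ.toHom 1).1 y = 0 ∨ (Φ.toHom 1).1 y = 1 := fun y => by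
    have h : Φ.toHom 1 * Φ.toHom 1 = Φ.toHom 1 := by rw [← map_mul, one_mul]
    have h' : (Φ.toHom 1).1 y * (Φ.toHom 1).1 y = (Φ.toHom 1).1 y :=
      congrArg (fun F : HInf Y => F.1 y) h
    rwa [← IsIdempotentElem, IsIdempotentElem.iff_eq_zero_or_one] at h'
  have hconn : PreconnectedSpace (UnitBall Y) :=
    Subtype.preconnectedSpace (convex_ball (0 : Y) 1).isPreconnected
  have hconst : ∀ y y', (Φ.toHom 1).1 y = (Φ.toHom 1).1 y' := fun y y' => by
    have hdisc : DiscreteTopology ({0, 1} : Set ℂ) := inferInstance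
    have := hconn.constant (f := fun y => (⟨(Φ.toHom 1).1 y, hidem y⟩ : ({0, 1} : Set ℂ)))
      ((Φ.toHom 1).1.continuous.subtype_mk _) (x := y) (y := y')
    exact congrArg Subtype.val this
  rcases hidem ⟨0, mem_ball_self one_pos⟩ with h0 | h1
  · refine absurd (NonUnitalAlgHom.ext fun f => ?_) Φ.ne_zero
    have h : Φ.toHom 1 = 0 := HInf.ext' fun y => (hconst y _).trans h0
    rw [← one_mul f, map_mul, h, zero_mul]
    rfl
  · exact HInf.ext' fun y => (hconst y _).trans h1

/-- The character `f ↦ Φ(f)(y)`. -/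
noncomputable def MInf.charAt (Φ : MInf X Y) (y : UnitBall Y) : HInf X →ₐ[ℂ] ℂ :=
  AlgHom.ofLinearMap
    { toFun := fun f => (Φ.toHom f).1 y
      map_add' := fun f g => by rw [map_add]; rfl
      map_smul' := fun c f => by rw [map_smul]; rfl }
    (by change (Φ.toHom 1).1 y = 1; rw [Φ.map_one]; rfl)
    fun f g => by change (Φ.toHom (f * g)).1 y = _; rw [map_mul]; rfl

theorem MInf.charAt_apply (Φ : MInf X Y) (y : UnitBall Y) (f : HInf X) :
    Φ.charAt y f = (Φ.toHom f).1 y := rfl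

theorem MInf.norm_charAt_le (Φ : MInf X Y) (y : UnitBall Y) (f : HInf X) :
    ‖Φ.charAt y f‖ ≤ ‖f‖ :=
  (HInf.norm_apply_le _ y).trans (Φ.norm_apply_le f)

theorem mem_fiber_iff {Φ : MInf X Y} {g : HInfVec Y (Bidual X)} :
    Φ ∈ fiber g ↔ ∀ y φ, (Φ.toHom (linFun φ)).1 y = g.1 y φ :=
  forall_congr' fun _ => ContinuousLinearMap.ext_iff

/-- On the algebra generated by the linear functionals, the elements of a fiber act by
evaluation of the extension. -/
theorem toHom_apply_of_mem_fiber {Φ : MInf X Y} {g : HInfVec Y (Bidual X)} (hg : ‖g‖ ≤ 1)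
    (hΦ : Φ ∈ fiber g) {f : HInf X} (hf : f ∈ linAlg X) (y : UnitBall Y) :
    (Φ.toHom f).1 y = character (valueInBall g hg y) f := by
  refine character_eq_of_linFun (χ := Φ.charAt y) (Φ.norm_charAt_le y) (norm_character_le _)
    (fun φ => ?_) hf
  rw [character_linFun, MInf.charAt_apply, mem_fiber_iff.1 hΦ]
  rfl

/-- The extension of an automorphism to the closed unit ball of the bidual. -/
noncomputable def extend (θ : BallAut X) (z : BidualBall X) : BidualBall X :=
  ballPoint (LinearMap.mkContinuous
    { toFun := fun φ => character z (θ.comp (linFun φ))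
      map_add' := fun φ ψ => by
        rw [← map_add, ← map_add]
        rfl
      map_smul' := fun c φ => by
        rw [RingHom.id_apply, ← map_smul, ← map_smul]
        rfl } 1 fun φ => by
    rw [one_mul]
    exact (norm_character_le _ _).trans ((θ.norm_comp_le _).trans (norm_linFun_le φ)))
  (LinearMap.mkContinuous_norm_le _ zero_le_one _)

theorem extend_apply (θ : BallAut X) (z : BidualBall X) (φ : StrongDual ℂ X) :
    (extend θ z).1 φ = character z (θ.comp (linFun φ)) := rfl

/-- The map `f ↦ character z (f ∘ θ)` is itself a contractive character, and its values on
functionals are by definition those of `extend θ z`. -/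
theorem character_extend (θ : BallAut X) (z : BidualBall X) {f : HInf X} (hf : f ∈ linAlg X) :
    character (extend θ z) f = character z (θ.comp f) :=
  character_eq_of_linFun (ψ := (character z).comp θ.comp) (norm_character_le _)
    (fun f => (norm_character_le z _).trans (θ.norm_comp_le f))
    (fun φ => by rw [character_linFun, extend_apply]; rfl) hf

theorem extend_symm_extend {θ : BallAut X} (hθ : ∀ φ, θ.symm.comp (linFun φ) ∈ linAlg X)
    (z : BidualBall X) : extend θ.symm (extend θ z) = z := by
  refine Subtype.ext (DFunLike.ext _ _ fun φ => ?_)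
  rw [extend_apply, character_extend θ z (hθ φ), θ.comp_symm_comp, character_linFun]

theorem continuous_extend {θ : BallAut X} (hθ : ∀ φ, θ.comp (linFun φ) ∈ linAlg X) :
    Continuous (extend θ) :=
  Continuous.subtype_mk (WeakDual.continuous_of_continuous_eval fun φ =>
    continuous_character (hθ φ)) _

theorem isCanonicalExtension_extend {θ : BallAut X}
    (hθ : ∀ φ, θ.comp (linFun φ) ∈ closure (finiteTypePoly X : Set (HInf X))) :
    IsCanonicalExtension θ (extend θ) :=
  ⟨continuous_extend fun φ => closure_finiteTypePoly_subset (hθ φ), fun z hz φ => by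
    rw [canonicalExt_eq_character (hθ φ) z hz, extend_apply]⟩

/-- The multiples `n / (n + 1) • z` lie in the open ball and tend to `z`. A canonical extension is
prescribed on the open ball only, so this density gives its uniqueness. -/
theorem dense_openBall_bidual :
    Dense {z : BidualBall X | ‖WeakDual.toStrongDual z.1‖ < 1} := by
  intro z
  have hn : ∀ t : ℝ, 0 ≤ t → ‖(t : ℂ) • WeakDual.toStrongDual z.1‖ ≤ t := fun t ht => by
    rw [norm_smul, Complex.norm_real, Real.norm_of_nonneg ht]
    exact (mul_le_mul_of_nonneg_left z.2 ht).trans_eq (mul_one t)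
  let t : ℕ → ℝ := fun n => n / (n + 1)
  have ht0 : ∀ n, 0 ≤ t n := fun n => by positivity
  have ht1 : ∀ n, t n < 1 := fun n => (div_lt_one (by positivity)).2 (lt_add_one _)
  refine mem_closure_of_tendsto (b := Filter.atTop)
    (f := fun n => ballPoint ((t n : ℂ) • WeakDual.toStrongDual z.1)
      ((hn _ (ht0 n)).trans (ht1 n).le)) ?_
    (Filter.Eventually.of_forall fun n => (hn _ (ht0 n)).trans_lt (ht1 n))
  rw [tendsto_subtype_rng, tendsto_iff_forall_eval_tendsto_topDualPairing]
  intro φ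
  have h1 : Filter.Tendsto (fun n => (t n : ℂ)) Filter.atTop (𝓝 1) := by
    have := (Complex.continuous_ofReal.tendsto 1).comp (tendsto_natCast_div_add_atTop (1 : ℝ))
    simpa using! this
  simpa using! h1.mul_const (z.1 φ)

theorem IsCanonicalExtension.unique {θ : BallAut X} {S T : BidualBall X → BidualBall X}
    (hS : IsCanonicalExtension θ S) (hT : IsCanonicalExtension θ T) : S = T := by
  refine Continuous.ext_on dense_openBall_bidual hS.1 hT.1 fun z hz => ?_
  exact Subtype.ext (DFunLike.ext _ _ fun φ => (hS.2 z hz φ).trans (hT.2 z hz φ).symm)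

/-- For each `φ` the scalar function `F φ` is holomorphic, and `φ ↦ F φ` is a contraction `L` into
`HInf Y`. The required map is the transpose of `L` composed with `evalAt`, which upgrades holomorphy
against each functional to holomorphy in norm. -/
theorem exists_extend_comp {θ : BallAut X} (hθ : ∀ φ, θ.comp (linFun φ) ∈ linAlg X)
    (g : HInfVec Y (Bidual X)) (hg : ‖g‖ ≤ 1) :
    ∃ h : HInfVec Y (Bidual X), ‖h‖ ≤ 1 ∧
      ∀ y, h.1 y = WeakDual.toStrongDual (extend θ (valueInBall g hg y)).1 := by
  choose F hF using fun φ => exists_character_comp g hg (hθ φ)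
  let L : StrongDual ℂ X →L[ℂ] HInf Y := LinearMap.mkContinuous
    { toFun := F
      map_add' := fun φ ψ => HInf.ext' fun y => by
        change _ = (F φ).1 y + (F ψ).1 y
        rw [hF, hF, hF, ← extend_apply, ← extend_apply, ← extend_apply]
        exact map_add (WeakDual.toStrongDual (extend θ (valueInBall g hg y)).1) φ ψ
      map_smul' := fun c φ => HInf.ext' fun y => by
        change _ = c • (F φ).1 y
        rw [hF, hF, ← extend_apply, ← extend_apply]
        exact map_smul (WeakDual.toStrongDual (extend θ (valueInBall g hg y)).1) c φ } 1
    fun φ => by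
      rw [one_mul]
      refine HInf.norm_le_of_forall (norm_nonneg φ) fun y => ?_
      change ‖(F φ).1 y‖ ≤ ‖φ‖
      rw [hF]
      exact (norm_character_le _ _).trans ((θ.norm_comp_le _).trans (norm_linFun_le φ))
  let P : StrongDual ℂ (HInf Y) →L[ℂ] Bidual X := ContinuousLinearMap.precomp ℂ L
  have hval : ∀ y, P (evalAt y) = WeakDual.toStrongDual (extend θ (valueInBall g hg y)).1 :=
    fun y => ContinuousLinearMap.ext fun φ => (hF φ y).trans (extend_apply θ _ φ).symm
  have hholo : IsHolo fun y : UnitBall Y => P (evalAt y) := isHolo_evalAt.clm_comp P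
  have hb : ∀ y, ‖P (evalAt y)‖ ≤ 1 := fun y => by
    rw [hval]
    exact (extend θ (valueInBall g hg y)).2
  refine ⟨⟨BoundedContinuousFunction.ofNormedAddCommGroup _ hholo.continuous 1 hb, hholo⟩, ?_, hval⟩
  exact BoundedContinuousFunction.norm_ofNormedAddCommGroup_le _ zero_le_one hb

theorem Lam_mem_fiber {θ : BallAut X} (hθ : ∀ φ, θ.comp (linFun φ) ∈ linAlg X)
    {g h : HInfVec Y (Bidual X)} (hg : ‖g‖ ≤ 1)
    (hh : ∀ y, h.1 y = WeakDual.toStrongDual (extend θ (valueInBall g hg y)).1)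
    {Φ : MInf X Y} (hΦ : Φ ∈ fiber g) : Lam θ Φ ∈ fiber h := by
  refine mem_fiber_iff.2 fun y φ => ?_
  rw [Lam_toHom, toHom_apply_of_mem_fiber hg hΦ (hθ φ), hh, ← extend_apply]
  rfl

theorem Lam_image_fiber {θ : BallAut X} (hθ : ∀ φ, θ.comp (linFun φ) ∈ linAlg X)
    (hθ' : ∀ φ, θ.symm.comp (linFun φ) ∈ linAlg X)
    {g h : HInfVec Y (Bidual X)} (hg : ‖g‖ ≤ 1) (hh1 : ‖h‖ ≤ 1)
    (hh : ∀ y, h.1 y = WeakDual.toStrongDual (extend θ (valueInBall g hg y)).1) :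
    Lam θ '' fiber g = fiber h := by
  refine Subset.antisymm (image_subset_iff.2 fun Φ hΦ => Lam_mem_fiber hθ hg hh hΦ) fun Ψ hΨ => ?_
  -- For the reverse inclusion, apply the forward one to `θ.symm` and `h`: since `extend θ.symm`
  -- undoes `extend θ`, the fiber over `h` is sent into the fiber over `g`.
  refine ⟨Lam θ.symm Ψ, Lam_mem_fiber hθ' hh1 (fun y => ?_) hΨ, Lam_Lam_symm θ Ψ⟩
  have : valueInBall h hh1 y = extend θ (valueInBall g hg y) := Subtype.ext (by
    change StrongDual.toWeakDual (h.1 y) = _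
    rw [hh]; rfl)
  rw [this, extend_symm_extend hθ']
  rfl

end Automorphisms
end VectorSpectrum

/-! ### The main theorem -/

theorem mainTheorem12 {X Y : Type*}
    [NormedAddCommGroup X] [NormedSpace ℂ X] [CompleteSpace X]
    [NormedAddCommGroup Y] [NormedSpace ℂ Y] [CompleteSpace Y]
    (θ : VectorSpectrum.BallAut X) :
    (Isometry (VectorSpectrum.Lam θ : VectorSpectrum.MInf X Y → VectorSpectrum.MInf X Y) ∧
      Function.Bijective
        (VectorSpectrum.Lam θ : VectorSpectrum.MInf X Y → VectorSpectrum.MInf X Y)) ∧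
    (VectorSpectrum.SymmetricallyRegular X →
      (∀ φ : StrongDual ℂ X,
        θ.comp (VectorSpectrum.linFun φ) ∈
            closure (VectorSpectrum.finiteTypePoly X : Set (VectorSpectrum.HInf X)) ∧
          θ.symm.comp (VectorSpectrum.linFun φ) ∈
            closure (VectorSpectrum.finiteTypePoly X : Set (VectorSpectrum.HInf X))) →
      ∃ T : VectorSpectrum.BidualBall X → VectorSpectrum.BidualBall X,
        VectorSpectrum.IsCanonicalExtension θ T ∧
        (∀ S : VectorSpectrum.BidualBall X → VectorSpectrum.BidualBall X,
          VectorSpectrum.IsCanonicalExtension θ S → S = T) ∧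
        ∀ (g : VectorSpectrum.HInfVec Y (VectorSpectrum.Bidual X)) (hg : ‖g‖ ≤ 1),
          ∃ h : VectorSpectrum.HInfVec Y (VectorSpectrum.Bidual X),
            ‖h‖ ≤ 1 ∧
            (∀ y, h.1 y =
              WeakDual.toStrongDual (T (VectorSpectrum.valueInBall g hg y)).1) ∧
            VectorSpectrum.Lam θ '' VectorSpectrum.fiber g = VectorSpectrum.fiber h) := by
  refine ⟨⟨VectorSpectrum.isometry_Lam θ, VectorSpectrum.bijective_Lam θ⟩, fun _ hθ => ?_⟩
  have hcan := VectorSpectrum.isCanonicalExtension_extend fun φ => (hθ φ).1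
  have h1 := fun φ => VectorSpectrum.closure_finiteTypePoly_subset (hθ φ).1
  have h2 := fun φ => VectorSpectrum.closure_finiteTypePoly_subset (hθ φ).2
  refine ⟨VectorSpectrum.extend θ, hcan, fun S hS => hS.unique hcan, fun g hg => ?_⟩
  obtain ⟨h, hh1, hh⟩ := VectorSpectrum.exists_extend_comp h1 g hg
  exact ⟨h, hh1, hh, VectorSpectrum.Lam_image_fiber h1 h2 hg hh1 hh⟩
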